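/- Let $n\ge 1$ and $1\le j\le n$ be integers. A convex body in $\mathbb R^n$ is a nonempty compact convex set (interior points are not required). Let $\omega_j$ denote the volume of the unit ball of $\mathbb R^j$, let $G_{n,j}$ be the Grassmann manifold of $j$-dimensional linear subspaces of $\mathbb R^n$ with its rotation-invariant Borel probability measure $\mu_j$, and let $\mathrm{vol}_j(K|\xi)$ be the $j$-dimensional volume of the orthogonal projection of $K$ onto $\xi\in G_{n,j}$. The affine quermassintegrals of a convex body $K$ are $\Phi_0(K)=V(K)$ (the volume of $K$), $\Phi_n(K)=\omega_n$, and, for $0<j<n$, $$\Phi_{n-j}(K)=\omega_n\left[\int_{G_{n,j}}\left(\frac{\mathrm{vol}_j(K|\xi)}{\omega_j}\right)^{-n}d\mu_j(\xi)\right]^{-1/n},$$ with the conventions $0^{-n}=\infty$ and $\infty^{-1/n}=0$ (needed only for bodies with empty interior). If $K$ and $L$ are convex bodies in $\mathbb R^n$ that contain the origin, then for every $\varepsilon>0$ $$\Phi_{n-j}(K+\varepsilon L)^{1/j}\ \ge\ \Phi_{n-j}(K)^{1/j}+\varepsilon\,\Phi_{n-j}(L)^{1/j},$$ where $K+\varepsilon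 L=\{x+\varepsilon y: x\in K,\ y\in L\}$. -/

import Mathlib

open MeasureTheory
open scoped ENNReal

noncomputable section

/-- Euclidean space `ℝⁿ`. -/
abbrev Euc (n : ℕ) : Type := EuclideanSpace ℝ (Fin n)

/-- The orthogonal group `O(n)`, as the group of orthogonal operators on `ℝⁿ`, with the topology of
the operator norm. -/
abbrev OrthGroup (n : ℕ) : Type := unitary (Euc n →L[ℝ] Euc n)

instance OrthGroup.instContinuousStar (n : ℕ) : ContinuousStar (Euc n →L[ℝ] Euc n) :=
  ⟨ContinuousLinearMap.adjoint.continuous⟩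

instance OrthGroup.instCompactSpace (n : ℕ) : CompactSpace (OrthGroup n) := by
  have : ProperSpace (Euc n →L[ℝ] Euc n) := FiniteDimensional.proper ℝ _
  have hc : IsClosed (unitary (Euc n →L[ℝ] Euc n) : Set (Euc n →L[ℝ] Euc n)) := isClosed_unitary
  have hb : Bornology.IsBounded (unitary (Euc n →L[ℝ] Euc n) : Set (Euc n →L[ℝ] Euc n)) := by
    refine (Metric.isBounded_closedBall (x := 0) (r := 1)).subset fun u hu => ?_
    rw [mem_closedBall_zero_iff]
    refine ContinuousLinearMap.opNorm_le_bound _ zero_le_one fun x => ?_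
    rw [one_mul]
    exact ((Unitary.linearIsometryEquiv ⟨u, hu⟩).norm_map x).le
  exact isCompact_iff_compactSpace.mp (Metric.isCompact_of_isClosed_isBounded hc hb)

/-- The Grassmann manifold `G_{n,j}` of `j`-dimensional linear subspaces of `ℝⁿ`. -/
structure Gr (n j : ℕ) where
  /-- The underlying subspace. -/
  space : Submodule ℝ (Euc n)
  finrank_eq : Module.finrank ℝ space = j

/-- The image `g ξ` of a `j`-dimensional subspace `ξ` under `g ∈ O(n)`. -/
def Gr.rotate {n j : ℕ} (g : OrthGroup n) (ξ : Gr n j) : Gr n j :=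
  ⟨ξ.space.map (g : Euc n →L[ℝ] Euc n).toLinearMap, by
    exact ((Unitary.linearIsometryEquiv g).toLinearEquiv.finrank_map_eq ξ.space).trans ξ.finrank_eq⟩

/-- The topology of `G_{n,j}` as a homogeneous space of `O(n)`, that is, the quotient topology under
the orbit map `g ↦ g ξ₀`. Since `O(n)` acts transitively on `G_{n,j}`, all base points `ξ₀` give the
same topology; the supremum avoids choosing one. -/
instance Gr.instTopologicalSpace (n j : ℕ) : TopologicalSpace (Gr n j) :=
  ⨆ ξ₀ : Gr n j, TopologicalSpace.coinduced (fun g : OrthGroup n => Gr.rotate g ξ₀) inferInstance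

/-- `G_{n,j}` carries its Borel `σ`-algebra. -/
instance Gr.instMeasurableSpace (n j : ℕ) : MeasurableSpace (Gr n j) := borel _

instance Gr.instBorelSpace (n j : ℕ) : BorelSpace (Gr n j) := ⟨rfl⟩

theorem Gr.continuous_rotate {n j : ℕ} (ξ₀ : Gr n j) :
    Continuous fun g : OrthGroup n => Gr.rotate g ξ₀ :=
  continuous_iff_coinduced_le.mpr
    (le_iSup (fun ξ : Gr n j =>
      TopologicalSpace.coinduced (fun g : OrthGroup n => Gr.rotate g ξ) inferInstance) ξ₀)

/-- The coordinate subspace spanned by the first `j` standard basis vectors of `ℝⁿ`. -/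
def Gr.coord {n j : ℕ} (h : j ≤ n) : Gr n j :=
  ⟨Submodule.span ℝ (Set.range fun i : Fin j =>
      EuclideanSpace.basisFun (Fin n) ℝ (Fin.castLE h i)), by
    have hli : LinearIndependent ℝ fun i : Fin j =>
        EuclideanSpace.basisFun (Fin n) ℝ (Fin.castLE h i) :=
      (EuclideanSpace.basisFun (Fin n) ℝ).orthonormal.linearIndependent.comp _
        (Fin.castLE_injective h)
    rw [finrank_span_eq_card hli, Fintype.card_fin]⟩

/-- The Haar probability measure on `O(n)`. -/
def orthHaar (n : ℕ) : Measure (OrthGroup n) := Measure.haarMeasure ⊤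

/-- The Haar probability measure `μ_j` on `G_{n,j}`: the image of the Haar probability measure of
`O(n)` under an orbit map. It is the rotation invariant Borel probability measure. -/
def Gr.haar {n j : ℕ} (h : j ≤ n) : Measure (Gr n j) :=
  (orthHaar n).map fun g => Gr.rotate g (Gr.coord h)

/-- `ω_j`, the volume of the unit ball of `ℝʲ`. -/
def ballVol (j : ℕ) : ℝ≥0∞ := volume (Metric.closedBall (0 : Euc j) 1)

/-- `vol_j (K | ξ)`, the `j`-dimensional volume (Lebesgue measure of the Euclidean space `ξ`) of the
orthogonal projection of `K` onto the `j`-dimensional subspace `ξ`. -/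
def projVol {n j : ℕ} (K : ConvexBody (Euc n)) (ξ : Gr n j) : ℝ≥0∞ :=
  volume (ξ.space.orthogonalProjectionOnto '' (K : Set (Euc n)))

/-- The affine quermassintegral `Φ_{n-j}(K)` for `0 ≤ j ≤ n`, indexed by the dimension `j` of the
subspaces: `Φ_n(K) = ω_n`, `Φ_0(K) = V(K)`, and for `0 < j < n`
`Φ_{n-j}(K) = ω_n [∫_{G_{n,j}} (vol_j(K|ξ) / ω_j)^{-n} dμ_j(ξ)]^{-1/n}`.
The bracket is computed in `[0, ∞]`, where `0 ^ (-n) = ∞` and `∞ ^ (-1/n) = 0`; this matters only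
for bodies without interior points. -/
def affineQuermass {n : ℕ} (j : ℕ) (K : ConvexBody (Euc n)) : ℝ :=
  if j = 0 then (ballVol n).toReal
  else if h : j < n then
    (ballVol n *
      (∫⁻ ξ : Gr n j, (projVol K ξ / ballVol j) ^ (-(n : ℝ)) ∂(Gr.haar h.le)) ^
        (-(1 / (n : ℝ)))).toReal
  else (volume (K : Set (Euc n))).toReal

end

/-! Orthogonal projection onto ξ is linear, so (K + L)|ξ = K|ξ + L|ξ, and the Brunn–Minkowski
inequality inside ξ makes vol_j(·|ξ)^{1/j} superadditive (`projVol_add`). Up to a constant factor,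
Φ_{n-j}^{1/j} is the power mean of (vol_j(·|ξ)/ω_j)^{1/j} with exponent -nj. Power means with
negative exponent are monotone and superadditive (`lintegral_rpow_neg_add_le`), so superadditivity
on each ξ passes to Φ_{n-j}^{1/j}. For j = n the claim is Brunn–Minkowski itself. Homogeneity of
degree j then brings in ε.

Brunn–Minkowski comes from Prékopa–Leindler: the line case follows from one-dimensional
Brunn–Minkowski on superlevel sets, higher dimensions by induction on coordinates. Integrals over
the Grassmannian need measurable projection volumes, which upper semicontinuity provides. -/

/-! ### Brunn–Minkowski on the line -/

open scoped Pointwise in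
/-- The one-dimensional Brunn–Minkowski inequality for compact sets. -/
theorem volume_add_volume_le_of_isCompact {A B C : Set ℝ} (hA : IsCompact A) (hB : IsCompact B)
    (hAn : A.Nonempty) (hBn : B.Nonempty) (hC : ∀ a ∈ A, ∀ b ∈ B, a + b ∈ C) :
    volume A + volume B ≤ volume C := by
  obtain ⟨a, haA, ha⟩ := hA.exists_isGreatest hAn
  obtain ⟨b, hbB, hb⟩ := hB.exists_isLeast hBn
  have hAt : volume (b +ᵥ A) = volume A := measure_vadd _ _ _
  have hBt : volume (a +ᵥ B) = volume B := measure_vadd _ _ _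
  -- With a = max A and b = min B, the translate b + A lies to the left of a + b and a + B to its
  -- right, so they share at most that point; both lie in C.
  have hI : volume ((b +ᵥ A) ∩ (a +ᵥ B)) = 0 := by
    refine measure_mono_null (t := {a + b}) ?_ (by simp)
    rintro _ ⟨⟨x, hx, rfl⟩, y, hy, hxy⟩
    simp only [vadd_eq_add] at hxy
    have := ha hx
    have := hb hy
    simp only [vadd_eq_add, Set.mem_singleton_iff]
    linarith
  have hmeas : MeasurableSet (a +ᵥ B) := (hB.vadd a).measurableSet
  rw [← hAt, ← hBt, ← measure_union_add_inter (b +ᵥ A) hmeas, hI, add_zero]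
  refine measure_mono (Set.union_subset ?_ ?_)
  · rintro _ ⟨x, hx, rfl⟩
    simpa [add_comm] using hC x hx b hbB
  · rintro _ ⟨y, hy, rfl⟩
    exact hC a haA y hy

/-- The one-dimensional Brunn–Minkowski inequality for measurable sets. -/
theorem volume_add_volume_le {A B C : Set ℝ} (hA : MeasurableSet A) (hB : MeasurableSet B)
    (hAn : A.Nonempty) (hBn : B.Nonempty) (hC : ∀ a ∈ A, ∀ b ∈ B, a + b ∈ C) :
    volume A + volume B ≤ volume C := by
  -- Inner regularity, restricted to nonempty compact sets: adjoining a point of S costs nothing.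
  have key : ∀ {S : Set ℝ}, MeasurableSet S → S.Nonempty → volume S =
      ⨆ K : {K : Set ℝ // K ⊆ S ∧ IsCompact K ∧ K.Nonempty}, volume K.1 := by
    intro S hS hSn
    obtain ⟨x, hx⟩ := hSn
    refine le_antisymm ?_ (iSup_le fun K => measure_mono K.2.1)
    rw [hS.measure_eq_iSup_isCompact]
    refine iSup_le fun K => iSup_le fun hK => iSup_le fun hKc => ?_
    refine le_trans (measure_mono (Set.subset_insert x K))
      (le_iSup (fun K : {K : Set ℝ // K ⊆ S ∧ IsCompact K ∧ K.Nonempty} => volume K.1)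
        ⟨insert x K, Set.insert_subset hx hK, hKc.insert x, Set.insert_nonempty _ _⟩)
  rw [key hA hAn, key hB hBn]
  obtain ⟨a, ha⟩ := hAn
  obtain ⟨b, hb⟩ := hBn
  have : Nonempty {K : Set ℝ // K ⊆ A ∧ IsCompact K ∧ K.Nonempty} :=
    ⟨{a}, by simpa using ha, isCompact_singleton, by simp⟩
  have : Nonempty {K : Set ℝ // K ⊆ B ∧ IsCompact K ∧ K.Nonempty} :=
    ⟨{b}, by simpa using hb, isCompact_singleton, by simp⟩
  exact ENNReal.iSup_add_iSup_le fun K L => volume_add_volume_le_of_isCompact K.2.2.1 L.2.2.1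
    K.2.2.2 L.2.2.2 fun a ha b hb => hC a (K.2.1 ha) b (L.2.1 hb)

open scoped Pointwise in
/-- The one-dimensional Brunn–Minkowski inequality for convex combinations. -/
theorem mul_volume_add_mul_volume_le {A B C : Set ℝ} (hA : MeasurableSet A)
    (hB : MeasurableSet B) (hAn : A.Nonempty) (hBn : B.Nonempty) {s t : ℝ} (hs : 0 < s)
    (ht : 0 < t) (hC : ∀ a ∈ A, ∀ b ∈ B, s * a + t * b ∈ C) :
    ENNReal.ofReal s * volume A + ENNReal.ofReal t * volume B ≤ volume C := by
  have hA' : MeasurableSet (s • A) := hA.const_smul₀ s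
  have hB' : MeasurableSet (t • B) := hB.const_smul₀ t
  have h := volume_add_volume_le (C := C) hA' hB' hAn.smul_set hBn.smul_set (by
    rintro _ ⟨a, ha, rfl⟩ _ ⟨b, hb, rfl⟩
    exact hC a ha b hb)
  rwa [Measure.addHaar_smul_of_nonneg _ hs.le, Measure.addHaar_smul_of_nonneg _ ht.le,
    Module.finrank_self, pow_one, pow_one] at h

/-! ### Prékopa–Leindler inequality -/

/-- The layer cake formula for functions with values in `[0, ∞)`, seen in `[0, ∞]`. -/
theorem lintegral_eq_lintegral_volume_ofReal_lt {f : ℝ → ℝ≥0∞} (hf : Measurable f)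
    (hfin : ∀ x, f x ≠ ∞) :
    ∫⁻ x, f x = ∫⁻ r in Set.Ioi (0 : ℝ), volume {x | ENNReal.ofReal r < f x} := by
  have h := lintegral_eq_lintegral_meas_lt (volume : Measure ℝ) (f := fun x => (f x).toReal)
    (Filter.Eventually.of_forall fun x => ENNReal.toReal_nonneg) hf.ennreal_toReal.aemeasurable
  simp only [ENNReal.ofReal_toReal (hfin _)] at h
  rw [h]
  refine setLIntegral_congr_fun measurableSet_Ioi fun r hr => ?_
  simp only [ENNReal.ofReal_lt_iff_lt_toReal (le_of_lt hr) (hfin _)]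

theorem ENNReal.rpow_mul_rpow_le_add {s t : ℝ} (hs : 0 < s) (ht : 0 < t) (hst : s + t = 1)
    (a b : ℝ≥0∞) : a ^ s * b ^ t ≤ ENNReal.ofReal s * a + ENNReal.ofReal t * b := by
  have hs' : ENNReal.ofReal s ≠ 0 := by simpa using hs
  have ht' : ENNReal.ofReal t ≠ 0 := by simpa using ht
  induction a with
  | top => simp [ENNReal.mul_top hs']
  | coe a =>
    induction b with
    | top => simp [ENNReal.mul_top ht']
    | coe b =>
      have h := NNReal.geom_mean_le_arith_mean2_weighted s.toNNReal t.toNNReal a b (by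
        rw [← Real.toNNReal_add hs.le ht.le, hst, Real.toNNReal_one])
      rw [Real.coe_toNNReal _ hs.le, Real.coe_toNNReal _ ht.le] at h
      rw [← ENNReal.coe_rpow_of_nonneg _ hs.le, ← ENNReal.coe_rpow_of_nonneg _ ht.le,
        ENNReal.ofReal, ENNReal.ofReal]
      exact_mod_cast h

/-- The one-dimensional Prékopa–Leindler inequality for functions with supremum `1`. -/
theorem prekopaLeindler_real_of_iSup_eq_one {s t : ℝ} (hs : 0 < s) (ht : 0 < t) (hst : s + t = 1)
    {f g h : ℝ → ℝ≥0∞} (hf : Measurable f) (hg : Measurable g) (hh : Measurable h)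
    (hf1 : ⨆ x, f x = 1) (hg1 : ⨆ x, g x = 1)
    (H : ∀ x y, f x ^ s * g y ^ t ≤ h (s * x + t * y)) :
    (∫⁻ x, f x) ^ s * (∫⁻ x, g x) ^ t ≤ ∫⁻ x, h x := by
  have hfle : ∀ x, f x ≤ 1 := fun x => hf1 ▸ le_iSup f x
  have hgle : ∀ x, g x ≤ 1 := fun x => hg1 ▸ le_iSup g x
  have hfin : ∀ {a : ℝ≥0∞}, a ≤ 1 → a ≠ ∞ := fun h => ne_top_of_le_ne_top ENNReal.one_ne_top h
  -- By weighted AM–GM, the stronger bound s∫f + t∫g ≤ ∫h suffices; it is linear and can be checked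
  -- level by level.
  refine (ENNReal.rpow_mul_rpow_le_add hs ht hst _ _).trans ?_
  -- Capping h at 1 makes it finite for the layer cake formula and loses nothing, since f and g have
  -- no levels above 1.
  refine le_trans ?_ (lintegral_mono fun x => min_le_left (h x) 1)
  have hanti : ∀ u : ℝ → ℝ≥0∞, Measurable fun r : ℝ => volume {x | ENNReal.ofReal r < u x} := by
    intro u
    refine Antitone.measurable fun r r' hr => measure_mono fun x hx => ?_
    exact lt_of_le_of_lt (ENNReal.ofReal_le_ofReal hr) hx
  rw [lintegral_eq_lintegral_volume_ofReal_lt hf fun x => hfin (hfle x),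
    lintegral_eq_lintegral_volume_ofReal_lt hg fun x => hfin (hgle x),
    lintegral_eq_lintegral_volume_ofReal_lt (hh.min measurable_const)
      fun x => hfin (min_le_right _ _),
    ← lintegral_const_mul _ (hanti f), ← lintegral_const_mul _ (hanti g),
    ← lintegral_add_left ((hanti f).const_mul _)]
  refine lintegral_mono fun r => ?_
  simp only
  rcases lt_or_ge (ENNReal.ofReal r) 1 with hr | hr
  -- Supremum 1 makes both superlevel sets nonempty for every r < 1, as one-dimensional
  -- Brunn–Minkowski requires.
  · refine mul_volume_add_mul_volume_le (hf measurableSet_Ioi) (hg measurableSet_Ioi)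
      (lt_iSup_iff.1 (hr.trans_eq hf1.symm))
      (lt_iSup_iff.1 (hr.trans_eq hg1.symm)) hs ht ?_
    intro a ha b hb
    refine lt_min (lt_of_lt_of_le ?_ (H a b)) hr
    calc ENNReal.ofReal r = ENNReal.ofReal r ^ s * ENNReal.ofReal r ^ t := by
          rw [← ENNReal.rpow_add_of_nonneg _ _ hs.le ht.le, hst, ENNReal.rpow_one]
      _ < f a ^ s * g b ^ t :=
          ENNReal.mul_lt_mul (ENNReal.rpow_lt_rpow ha hs) (ENNReal.rpow_lt_rpow hb ht)
  · have h1 : {x | ENNReal.ofReal r < f x} = ∅ :=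
      Set.eq_empty_of_forall_notMem fun x hx => absurd hx (((hfle x).trans hr).not_gt)
    have h2 : {x | ENNReal.ofReal r < g x} = ∅ :=
      Set.eq_empty_of_forall_notMem fun x hx => absurd hx (((hgle x).trans hr).not_gt)
    simp [h1, h2]

/-- The one-dimensional Prékopa–Leindler inequality for bounded functions. -/
theorem prekopaLeindler_real_of_bounded {s t : ℝ} (hs : 0 < s) (ht : 0 < t) (hst : s + t = 1)
    {f g h : ℝ → ℝ≥0∞} (hf : Measurable f) (hg : Measurable g) (hh : Measurable h)
    (hfb : ⨆ x, f x ≠ ∞) (hgb : ⨆ x, g x ≠ ∞)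
    (H : ∀ x y, f x ^ s * g y ^ t ≤ h (s * x + t * y)) :
    (∫⁻ x, f x) ^ s * (∫⁻ x, g x) ^ t ≤ ∫⁻ x, h x := by
  set a := ⨆ x, f x with ha
  set b := ⨆ x, g x with hb
  rcases eq_or_ne a 0 with ha0 | ha0
  · have : ∀ x, f x = 0 := fun x => le_antisymm (ha0 ▸ le_iSup f x) zero_le
    simp [this, hs]
  rcases eq_or_ne b 0 with hb0 | hb0
  · have : ∀ x, g x = 0 := fun x => le_antisymm (hb0 ▸ le_iSup g x) zero_le
    simp [this, ht]
  have hc0 : a ^ s * b ^ t ≠ 0 := by simp [ha0, hb0, hfb, hgb]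
  have hct : a ^ s * b ^ t ≠ ∞ := ENNReal.mul_ne_top (ENNReal.rpow_ne_top_of_nonneg hs.le hfb)
    (ENNReal.rpow_ne_top_of_nonneg ht.le hgb)
  have hinv : (a⁻¹) ^ s * (b⁻¹) ^ t = (a ^ s * b ^ t)⁻¹ := by
    rw [ENNReal.inv_rpow, ENNReal.inv_rpow, ENNReal.mul_inv (by simp [ha0, hfb]) (by simp [hb0, hgb])]
  -- Dividing f, g, h by a, b, a^s b^t preserves the hypothesis and normalizes both suprema to 1.
  have hP := prekopaLeindler_real_of_iSup_eq_one hs ht hst (f := fun x => a⁻¹ * f x)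
    (g := fun x => b⁻¹ * g x) (h := fun x => (a ^ s * b ^ t)⁻¹ * h x) (hf.const_mul _)
    (hg.const_mul _) (hh.const_mul _)
    (by rw [← ENNReal.mul_iSup, ENNReal.inv_mul_cancel ha0 hfb])
    (by rw [← ENNReal.mul_iSup, ENNReal.inv_mul_cancel hb0 hgb]) (by
      intro x y
      rw [ENNReal.mul_rpow_of_nonneg _ _ hs.le, ENNReal.mul_rpow_of_nonneg _ _ ht.le,
        mul_mul_mul_comm, hinv]
      gcongr
      exact H x y)
  rw [lintegral_const_mul _ hf, lintegral_const_mul _ hg, lintegral_const_mul _ hh,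
    ENNReal.mul_rpow_of_nonneg _ _ hs.le, ENNReal.mul_rpow_of_nonneg _ _ ht.le,
    mul_mul_mul_comm, hinv] at hP
  exact (ENNReal.mul_le_mul_iff_right (ENNReal.inv_ne_zero.2 hct) (ENNReal.inv_ne_top.2 hc0)).1 hP

/-- The one-dimensional Prékopa–Leindler inequality. -/
theorem prekopaLeindler_real {s t : ℝ} (hs : 0 < s) (ht : 0 < t) (hst : s + t = 1)
    {f g h : ℝ → ℝ≥0∞} (hf : Measurable f) (hg : Measurable g) (hh : Measurable h)
    (H : ∀ x y, f x ^ s * g y ^ t ≤ h (s * x + t * y)) :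
    (∫⁻ x, f x) ^ s * (∫⁻ x, g x) ^ t ≤ ∫⁻ x, h x := by
  have hlim : ∀ {u : ℝ → ℝ≥0∞}, Measurable u → Filter.Tendsto
      (fun n : ℕ => ∫⁻ x, min (u x) n) Filter.atTop (nhds (∫⁻ x, u x)) := by
    intro u hu
    refine lintegral_tendsto_of_tendsto_of_monotone
      (fun n => (hu.min measurable_const).aemeasurable)
      (Filter.Eventually.of_forall fun x m n hmn => min_le_min_left _ (by exact_mod_cast hmn))
      (Filter.Eventually.of_forall fun x => ?_)
    have := (tendsto_const_nhds (x := u x)).min ENNReal.tendsto_nat_nhds_top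
    simpa using this
  rcases eq_or_ne (∫⁻ x, f x) 0 with hf0 | hf0
  · simp [hf0, hs]
  rcases eq_or_ne (∫⁻ x, g x) 0 with hg0 | hg0
  · simp [hg0, ht]
  -- Truncate f and g at height n and pass to the limit; excluding zero integrals avoids 0 · ∞,
  -- where multiplication is discontinuous.
  refine le_of_tendsto' (ENNReal.Tendsto.mul ((hlim hf).ennrpow_const s) (Or.inl ?_)
    ((hlim hg).ennrpow_const t) (Or.inl ?_)) fun n => ?_
  · simp [ENNReal.rpow_eq_zero_iff, hf0, hs.le]
  · simp [ENNReal.rpow_eq_zero_iff, hg0, ht.le]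
  · have hb : ∀ u : ℝ → ℝ≥0∞, ⨆ x, min (u x) (n : ℝ≥0∞) ≠ ∞ := fun u =>
      ne_top_of_le_ne_top (ENNReal.natCast_ne_top n) (iSup_le fun x => min_le_right _ _)
    refine prekopaLeindler_real_of_bounded hs ht hst (hf.min measurable_const)
      (hg.min measurable_const) hh (hb f) (hb g) fun x y => le_trans ?_ (H x y)
    gcongr <;> exact min_le_left _ _

theorem lintegral_fin_succ {n : ℕ} {f : (Fin (n + 1) → ℝ) → ℝ≥0∞} (hf : Measurable f) :
    ∫⁻ x, f x = ∫⁻ r : ℝ, ∫⁻ v : Fin n → ℝ, f (Fin.cons r v) := by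
  have h := (volume_preserving_piFinSuccAbove (fun _ : Fin (n + 1) => ℝ) 0).symm
  rw [← h.lintegral_comp hf]
  refine (lintegral_prod _ (hf.comp h.measurable).aemeasurable).trans ?_
  simp [MeasurableEquiv.piFinSuccAbove, Fin.insertNthEquiv]

theorem measurable_fin_cons {n : ℕ} :
    Measurable fun p : ℝ × (Fin n → ℝ) => (Fin.cons p.1 p.2 : Fin (n + 1) → ℝ) := by
  refine measurable_pi_iff.2 fun i => ?_
  refine Fin.cases ?_ (fun i => ?_) i
  · simpa using measurable_fst
  · simpa using measurable_pi_iff.1 measurable_snd i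

/-- The Prékopa–Leindler inequality on `Fin n → ℝ`. -/
theorem prekopaLeindler_pi {s t : ℝ} (hs : 0 < s) (ht : 0 < t) (hst : s + t = 1) (n : ℕ)
    {f g h : (Fin n → ℝ) → ℝ≥0∞} (hf : Measurable f) (hg : Measurable g) (hh : Measurable h)
    (H : ∀ x y, f x ^ s * g y ^ t ≤ h (s • x + t • y)) :
    (∫⁻ x, f x) ^ s * (∫⁻ x, g x) ^ t ≤ ∫⁻ x, h x := by
  induction n with
  | zero =>
    have hint : ∀ u : (Fin 0 → ℝ) → ℝ≥0∞, ∫⁻ x, u x = u default := fun u => by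
      rw [lintegral_unique, volume_pi, Measure.pi_of_empty, measure_univ, mul_one]
      exact congrArg u (Subsingleton.elim _ _)
    rw [hint, hint, hint]
    exact (H default default).trans_eq (congrArg h (Subsingleton.elim _ _))
  | succ n ih =>
    have hsec : ∀ {u : (Fin (n + 1) → ℝ) → ℝ≥0∞}, Measurable u →
        Measurable fun p : ℝ × (Fin n → ℝ) => u (Fin.cons p.1 p.2) :=
      fun hu => hu.comp measurable_fin_cons
    rw [lintegral_fin_succ hf, lintegral_fin_succ hg, lintegral_fin_succ hh]
    -- The integrals over the fibres satisfy the one-dimensional hypothesis by the induction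
    -- hypothesis.
    refine prekopaLeindler_real hs ht hst (hsec hf).lintegral_prod_right'
      (hsec hg).lintegral_prod_right' (hsec hh).lintegral_prod_right' fun x y => ?_
    refine ih ((hsec hf).comp measurable_prodMk_left) ((hsec hg).comp measurable_prodMk_left)
      ((hsec hh).comp measurable_prodMk_left) fun v w => ?_
    refine (H _ _).trans_eq (congrArg h ?_)
    ext i
    refine Fin.cases ?_ (fun i => ?_) i <;> simp

/-! ### Brunn–Minkowski in Euclidean spaces -/

section InnerProductSpace

variable {E : Type*} [NormedAddCommGroup E] [InnerProductSpace ℝ E] [FiniteDimensional ℝ E]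
  [MeasurableSpace E] [BorelSpace E]

/-- The Prékopa–Leindler inequality on a Euclidean space. -/
theorem prekopaLeindler {s t : ℝ} (hs : 0 < s) (ht : 0 < t) (hst : s + t = 1)
    {f g h : E → ℝ≥0∞} (hf : Measurable f) (hg : Measurable g) (hh : Measurable h)
    (H : ∀ x y, f x ^ s * g y ^ t ≤ h (s • x + t • y)) :
    (∫⁻ x, f x) ^ s * (∫⁻ x, g x) ^ t ≤ ∫⁻ x, h x := by
  let b := stdOrthonormalBasis ℝ E
  have hφ : MeasurePreserving (fun v => b.repr.symm (WithLp.toLp 2 v)) :=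
    b.measurePreserving_repr_symm.comp (PiLp.volume_preserving_toLp _)
  rw [← hφ.lintegral_comp hf, ← hφ.lintegral_comp hg, ← hφ.lintegral_comp hh]
  refine prekopaLeindler_pi hs ht hst _ (hf.comp hφ.measurable) (hg.comp hφ.measurable)
    (hh.comp hφ.measurable) fun x y => (H _ _).trans_eq (congrArg h ?_)
  simp only [WithLp.toLp_add, WithLp.toLp_smul, map_add, map_smul]

open scoped Pointwise in
/-- The multiplicative form of the Brunn–Minkowski inequality. -/
theorem volume_rpow_mul_volume_rpow_le {s t : ℝ} (hs : 0 < s) (ht : 0 < t) (hst : s + t = 1)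
    {A B : Set E} (hA : IsCompact A) (hB : IsCompact B) :
    volume A ^ s * volume B ^ t ≤ volume (s • A + t • B) := by
  have hC : MeasurableSet (s • A + t • B) := ((hA.smul s).add (hB.smul t)).measurableSet
  have h := prekopaLeindler hs ht hst (f := A.indicator 1) (g := B.indicator 1)
    (h := (s • A + t • B).indicator 1) (measurable_one.indicator hA.measurableSet)
    (measurable_one.indicator hB.measurableSet) (measurable_one.indicator hC) (by
      intro x y
      by_cases hx : x ∈ A
      · by_cases hy : y ∈ B
        · rw [Set.indicator_of_mem hx, Set.indicator_of_mem hy, Set.indicator_of_mem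
            (Set.add_mem_add (Set.smul_mem_smul_set hx) (Set.smul_mem_smul_set hy))]
          simp
        · simp [hy, ht]
      · simp [hx, hs])
  rwa [lintegral_indicator_one hA.measurableSet, lintegral_indicator_one hB.measurableSet,
    lintegral_indicator_one hC] at h

open scoped Pointwise in
/-- The Brunn–Minkowski inequality for compact sets. -/
theorem brunnMinkowski {A B : Set E} (hA : IsCompact A) (hB : IsCompact B) (hAn : A.Nonempty)
    (hBn : B.Nonempty) {d : ℕ} (hd : Module.finrank ℝ E = d) (hd0 : 0 < d) :
    volume A ^ (1 / (d : ℝ)) + volume B ^ (1 / (d : ℝ)) ≤ volume (A + B) ^ (1 / (d : ℝ)) := by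
  have hd' : 0 < 1 / (d : ℝ) := by positivity
  have hroot : ∀ v : ℝ≥0∞, (v ^ (1 / (d : ℝ))) ^ d = v := fun v => by
    rw [← ENNReal.rpow_natCast, ← ENNReal.rpow_mul, one_div_mul_cancel (by positivity),
      ENNReal.rpow_one]
  rcases eq_or_ne (volume A) 0 with hA0 | hA0
  · obtain ⟨a, ha⟩ := hAn
    rw [hA0, ENNReal.zero_rpow_of_pos hd', zero_add, ← measure_vadd volume a B]
    refine ENNReal.rpow_le_rpow (measure_mono ?_) hd'.le
    rintro _ ⟨b, hb, rfl⟩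
    exact Set.add_mem_add ha hb
  rcases eq_or_ne (volume B) 0 with hB0 | hB0
  · obtain ⟨b, hb⟩ := hBn
    rw [hB0, ENNReal.zero_rpow_of_pos hd', add_zero, ← measure_vadd volume b A]
    refine ENNReal.rpow_le_rpow (measure_mono ?_) hd'.le
    rintro _ ⟨a, ha, rfl⟩
    simpa [add_comm] using Set.add_mem_add ha hb
  have hfin : ∀ {S : Set E}, IsCompact S → volume S ^ (1 / (d : ℝ)) ≠ ∞ := fun hS =>
    ENNReal.rpow_ne_top_of_nonneg hd'.le hS.measure_lt_top.ne
  have hpos : ∀ {S : Set E}, IsCompact S → volume S ≠ 0 →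
      0 < (volume S ^ (1 / (d : ℝ))).toReal := fun hS h0 =>
    ENNReal.toReal_pos (by simp [ENNReal.rpow_eq_zero_iff, h0, hS.measure_lt_top.ne])
      (hfin hS)
  obtain ⟨a, ha⟩ : ∃ a, a = (volume A ^ (1 / (d : ℝ))).toReal := ⟨_, rfl⟩
  obtain ⟨b, hb⟩ : ∃ b, b = (volume B ^ (1 / (d : ℝ))).toReal := ⟨_, rfl⟩
  have ha0 : 0 < a := ha ▸ hpos hA hA0
  have hb0 : 0 < b := hb ▸ hpos hB hB0
  have hac : volume A ^ (1 / (d : ℝ)) = ENNReal.ofReal a := by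
    rw [ha, ENNReal.ofReal_toReal (hfin hA)]
  have hbc : volume B ^ (1 / (d : ℝ)) = ENNReal.ofReal b := by
    rw [hb, ENNReal.ofReal_toReal (hfin hB)]
  have hunit : ∀ {S : Set E} {c : ℝ}, 0 < c → volume S ^ (1 / (d : ℝ)) = ENNReal.ofReal c →
      volume (c⁻¹ • S) = 1 := by
    intro S c hc hS
    rw [Measure.addHaar_smul_of_nonneg _ (inv_nonneg.2 hc.le), hd, ← hroot (volume S), hS,
      ← ENNReal.ofReal_pow hc.le, ← ENNReal.ofReal_mul (by positivity), ← mul_pow,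
      inv_mul_cancel₀ hc.ne', one_pow, ENNReal.ofReal_one]
  -- A/a and B/b have volume 1, and these weights combine them into (A + B)/(a + b), which therefore
  -- has volume at least 1.
  have hP := volume_rpow_mul_volume_rpow_le (s := a / (a + b)) (t := b / (a + b)) (by positivity)
    (by positivity) (by field_simp) (hA.smul a⁻¹) (hB.smul b⁻¹)
  rw [hunit ha0 hac, hunit hb0 hbc, ENNReal.one_rpow, ENNReal.one_rpow, one_mul, smul_smul,
    smul_smul, show a / (a + b) * a⁻¹ = (a + b)⁻¹ by field_simp,
    show b / (a + b) * b⁻¹ = (a + b)⁻¹ by field_simp, ← smul_add,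
    Measure.addHaar_smul_of_nonneg _ (by positivity), hd] at hP
  rw [hac, hbc, ← ENNReal.ofReal_add ha0.le hb0.le, one_div, ENNReal.le_rpow_inv_iff (by positivity),
    ENNReal.rpow_natCast, ← ENNReal.ofReal_pow (by positivity)]
  have hab : (a + b) ^ d * (a + b)⁻¹ ^ d = 1 := by
    rw [← mul_pow, mul_inv_cancel₀ (by positivity), one_pow]
  calc ENNReal.ofReal ((a + b) ^ d)
      ≤ ENNReal.ofReal ((a + b) ^ d) * (ENNReal.ofReal ((a + b)⁻¹ ^ d) * volume (A + B)) :=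
        le_mul_of_one_le_right' hP
    _ = volume (A + B) := by
        rw [← mul_assoc, ← ENNReal.ofReal_mul (by positivity), hab, ENNReal.ofReal_one, one_mul]

end InnerProductSpace

/-! ### Power means with negative exponent -/

theorem ENNReal.const_mul_rpow {c : ℝ≥0∞} (h0 : c ≠ 0) (ht : c ≠ ∞) (x : ℝ≥0∞) (z : ℝ) :
    (c * x) ^ z = c ^ z * x ^ z := by
  rw [ENNReal.mul_rpow_eq_ite, if_neg (by simp [h0, ht])]

theorem ENNReal.rpow_neg_le_rpow_neg {x y : ℝ≥0∞} {p : ℝ} (hp : 0 ≤ p) (h : x ≤ y) :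
    y ^ (-p) ≤ x ^ (-p) := by
  rw [ENNReal.rpow_neg, ENNReal.rpow_neg]
  exact ENNReal.inv_le_inv.2 (ENNReal.rpow_le_rpow h hp)

/-- Convexity of negative powers on `[0, ∞]`. -/
theorem ENNReal.rpow_neg_convex {s t : ℝ} (hs : 0 < s) (ht : 0 < t) (hst : s + t = 1)
    {p : ℝ} (hp : 0 < p) (x y : ℝ≥0∞) :
    (ENNReal.ofReal s * x + ENNReal.ofReal t * y) ^ (-p) ≤
      ENNReal.ofReal s * x ^ (-p) + ENNReal.ofReal t * y ^ (-p) := by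
  have hs' : ENNReal.ofReal s ≠ 0 := by simpa using hs
  have ht' : ENNReal.ofReal t ≠ 0 := by simpa using ht
  rcases eq_or_ne x 0 with rfl | hx
  · simp [ENNReal.zero_rpow_of_neg (neg_lt_zero.2 hp), ENNReal.mul_top hs']
  rcases eq_or_ne y 0 with rfl | hy
  · simp [ENNReal.zero_rpow_of_neg (neg_lt_zero.2 hp), ENNReal.mul_top ht']
  -- AM–GM is used twice: under the decreasing power -p, and again on the powers themselves.
  calc (ENNReal.ofReal s * x + ENNReal.ofReal t * y) ^ (-p)
      ≤ (x ^ s * y ^ t) ^ (-p) :=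
        ENNReal.rpow_neg_le_rpow_neg hp.le (ENNReal.rpow_mul_rpow_le_add hs ht hst x y)
    _ = (x ^ (-p)) ^ s * (y ^ (-p)) ^ t := by
        rw [ENNReal.mul_rpow_of_ne_zero (by simp [ENNReal.rpow_eq_zero_iff, hx, hs.le])
          (by simp [ENNReal.rpow_eq_zero_iff, hy, ht.le])]
        simp only [← ENNReal.rpow_mul, mul_comm]
    _ ≤ _ := ENNReal.rpow_mul_rpow_le_add hs ht hst _ _

/-- The reverse Minkowski inequality for negative exponents. -/
theorem lintegral_rpow_neg_add_le {α : Type*} [MeasurableSpace α] (μ : Measure α) {p : ℝ}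
    (hp : 0 < p) {f g : α → ℝ≥0∞} (hf : Measurable f) (hg : Measurable g) :
    (∫⁻ x, f x ^ (-p) ∂μ) ^ (-(1 / p)) + (∫⁻ x, g x ^ (-p) ∂μ) ^ (-(1 / p)) ≤
      (∫⁻ x, (f x + g x) ^ (-p) ∂μ) ^ (-(1 / p)) := by
  have hp' : 0 ≤ 1 / p := by positivity
  have hlef : (∫⁻ x, f x ^ (-p) ∂μ) ^ (-(1 / p)) ≤ (∫⁻ x, (f x + g x) ^ (-p) ∂μ) ^ (-(1 / p)) :=
    ENNReal.rpow_neg_le_rpow_neg hp' (lintegral_mono fun x =>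
      ENNReal.rpow_neg_le_rpow_neg hp.le le_self_add)
  have hleg : (∫⁻ x, g x ^ (-p) ∂μ) ^ (-(1 / p)) ≤ (∫⁻ x, (f x + g x) ^ (-p) ∂μ) ^ (-(1 / p)) :=
    ENNReal.rpow_neg_le_rpow_neg hp' (lintegral_mono fun x =>
      ENNReal.rpow_neg_le_rpow_neg hp.le le_add_self)
  have hroot : ∀ v : ℝ≥0∞, (v ^ (-(1 / p))) ^ (-p) = v := fun v => by
    rw [← ENNReal.rpow_mul, show -(1 / p) * -p = 1 by field_simp, ENNReal.rpow_one]
  have hroot' : ∀ v : ℝ≥0∞, (v ^ (-p)) ^ (-(1 / p)) = v := fun v => by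
    rw [← ENNReal.rpow_mul, show -p * -(1 / p) = 1 by field_simp, ENNReal.rpow_one]
  generalize ha : (∫⁻ x, f x ^ (-p) ∂μ) ^ (-(1 / p)) = a at *
  generalize hb : (∫⁻ x, g x ^ (-p) ∂μ) ^ (-(1 / p)) = b at *
  rcases eq_or_ne a 0 with rfl | ha0
  · rwa [zero_add]
  rcases eq_or_ne b 0 with rfl | hb0
  · rwa [add_zero]
  rcases eq_or_ne a ∞ with rfl | hat
  · exact le_top.trans hlef
  rcases eq_or_ne b ∞ with rfl | hbt
  · exact le_top.trans hleg
  have hfa : ∫⁻ x, f x ^ (-p) ∂μ = a ^ (-p) := by rw [← ha, hroot]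
  have hgb : ∫⁻ x, g x ^ (-p) ∂μ = b ^ (-p) := by rw [← hb, hroot]
  lift a to NNReal using hat
  lift b to NNReal using hbt
  have ha0' : 0 < (a : ℝ) := by
    exact_mod_cast pos_iff_ne_zero.2 (by exact_mod_cast ha0 : a ≠ 0)
  have hb0' : 0 < (b : ℝ) := by
    exact_mod_cast pos_iff_ne_zero.2 (by exact_mod_cast hb0 : b ≠ 0)
  have hnorm : ∀ {c : NNReal} {u : α → ℝ≥0∞}, (c : ℝ≥0∞) ≠ 0 → Measurable u →
      ∫⁻ x, u x ^ (-p) ∂μ = (c : ℝ≥0∞) ^ (-p) →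
      ∫⁻ x, ((c : ℝ≥0∞)⁻¹ * u x) ^ (-p) ∂μ = 1 := by
    intro c u hc hu hI
    simp only [ENNReal.const_mul_rpow (ENNReal.inv_ne_zero.2 ENNReal.coe_ne_top)
      (ENNReal.inv_ne_top.2 hc)]
    rw [lintegral_const_mul _ (hu.pow_const _), hI, ← ENNReal.const_mul_rpow
      (ENNReal.inv_ne_zero.2 ENNReal.coe_ne_top) (ENNReal.inv_ne_top.2 hc),
      ENNReal.inv_mul_cancel hc ENNReal.coe_ne_top, ENNReal.one_rpow]
  have hab0 : (a : ℝ≥0∞) + b ≠ 0 := by simp [ha0]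
  have habt : (a : ℝ≥0∞) + b ≠ ∞ := by simp
  have hs : 0 < (a : ℝ) / (a + b) := by positivity
  have ht : 0 < (b : ℝ) / (a + b) := by positivity
  have hst : (a : ℝ) / (a + b) + b / (a + b) = 1 := by field_simp
  have hcoef : ∀ c : NNReal, ENNReal.ofReal ((c : ℝ) / (a + b)) = c / (a + b) := fun c => by
    rw [ENNReal.ofReal_div_of_pos (by positivity), ENNReal.ofReal_add (by simp) (by simp)]
    simp
  have hsplit : ∀ {c : NNReal} (z : ℝ≥0∞), (c : ℝ≥0∞) ≠ 0 →
      ((a : ℝ≥0∞) + b) * ((c / (a + b)) * ((c : ℝ≥0∞)⁻¹ * z)) = z := fun {c} z hc => by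
    rw [← mul_assoc, ENNReal.mul_div_cancel hab0 habt, ← mul_assoc,
      ENNReal.mul_inv_cancel hc ENNReal.coe_ne_top, one_mul]
  -- f + g is a + b times the convex combination of f/a and g/b with weights a/(a+b) and b/(a+b).
  -- Convexity applies, and each normalized power integrates to 1.
  have hpt : ∀ x, (f x + g x) ^ (-p) ≤ ((a : ℝ≥0∞) + b) ^ (-p) *
      (ENNReal.ofReal ((a : ℝ) / (a + b)) * ((a : ℝ≥0∞)⁻¹ * f x) ^ (-p) +
        ENNReal.ofReal ((b : ℝ) / (a + b)) * ((b : ℝ≥0∞)⁻¹ * g x) ^ (-p)) := by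
    intro x
    have hx : f x + g x = ((a : ℝ≥0∞) + b) *
        (ENNReal.ofReal ((a : ℝ) / (a + b)) * ((a : ℝ≥0∞)⁻¹ * f x) +
          ENNReal.ofReal ((b : ℝ) / (a + b)) * ((b : ℝ≥0∞)⁻¹ * g x)) := by
      rw [hcoef, hcoef, mul_add, hsplit _ ha0, hsplit _ hb0]
    rw [hx, ENNReal.const_mul_rpow hab0 habt]
    gcongr
    exact ENNReal.rpow_neg_convex hs ht hst hp _ _
  have hI : ∫⁻ x, (f x + g x) ^ (-p) ∂μ ≤ ((a : ℝ≥0∞) + b) ^ (-p) := by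
    have hfm : Measurable fun x => ((a : ℝ≥0∞)⁻¹ * f x) ^ (-p) := (hf.const_mul _).pow_const _
    have hgm : Measurable fun x => ((b : ℝ≥0∞)⁻¹ * g x) ^ (-p) := (hg.const_mul _).pow_const _
    refine (lintegral_mono hpt).trans_eq ?_
    rw [lintegral_const_mul _ (by fun_prop),
      lintegral_add_left (hfm.const_mul _), lintegral_const_mul _ hfm, lintegral_const_mul _ hgm,
      hnorm ha0 hf hfa, hnorm hb0 hg hgb, mul_one, mul_one, ← ENNReal.ofReal_add hs.le ht.le, hst,
      ENNReal.ofReal_one, mul_one]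
  calc (a : ℝ≥0∞) + b = (((a : ℝ≥0∞) + b) ^ (-p)) ^ (-(1 / p)) := (hroot' _).symm
    _ ≤ _ := ENNReal.rpow_neg_le_rpow_neg hp' hI

/-! ### Projection volumes on the Grassmannian -/

theorem projVol_ne_top {n j : ℕ} (K : ConvexBody (Euc n)) (ξ : Gr n j) : projVol K ξ ≠ ∞ :=
  (K.isCompact.image ξ.space.orthogonalProjectionOnto.continuous).measure_lt_top.ne

/-- The projection onto gξ is g P_ξ g*, and g maps ξ isometrically onto gξ. Along an orbit the
volume is thus measured in one fixed space ξ. -/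
theorem projVol_rotate {n j : ℕ} (K : ConvexBody (Euc n)) (g : OrthGroup n) (ξ : Gr n j) :
    projVol K (Gr.rotate g ξ) =
      volume ((fun x => ξ.space.orthogonalProjectionOnto
        (((star g : OrthGroup n) : Euc n →L[ℝ] Euc n) x)) '' (K : Set (Euc n))) := by
  let U := Unitary.linearIsometryEquiv g
  let φ : ξ.space ≃ₗᵢ[ℝ] (Gr.rotate g ξ).space := U.submoduleMap ξ.space
  have hφ : ∀ x, (Gr.rotate g ξ).space.orthogonalProjectionOnto x =
      φ (ξ.space.orthogonalProjectionOnto (((star g : OrthGroup n) : Euc n →L[ℝ] Euc n) x)) := by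
    intro x
    apply Subtype.ext
    have h := Submodule.starProjection_map_apply U ξ.space x
    exact h
  have hS : IsCompact ((fun x => ξ.space.orthogonalProjectionOnto
      (((star g : OrthGroup n) : Euc n →L[ℝ] Euc n) x)) '' (K : Set (Euc n))) :=
    K.isCompact.image (by fun_prop)
  rw [projVol, ← φ.symm.measurePreserving.measure_preimage hS.measurableSet.nullMeasurableSet,
    ← φ.image_eq_preimage_symm, Set.image_image]
  simp only [hφ]

/-- The volume of the projections of a convex body depends upper semicontinuously on the
subspace. -/
theorem upperSemicontinuous_projVol {n j : ℕ} (K : ConvexBody (Euc n)) :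
    UpperSemicontinuous (projVol K : Gr n j → ℝ≥0∞) := by
  rw [upperSemicontinuous_iff_isOpen_preimage]
  intro c
  refine isOpen_iSup_iff.2 fun ξ => isOpen_coinduced.2 (isOpen_iff_mem_nhds.2 fun g hg => ?_)
  simp only [Set.mem_preimage, Set.mem_Iio, projVol_rotate] at hg
  -- Outer regularity gives an open V around the projected body with volume still below c;
  -- compactness of K keeps the image inside V for all g' near g.
  obtain ⟨V, hKV, hVo, hV⟩ := Set.exists_isOpen_lt_of_lt _ _ hg
  have hcont : Continuous fun q : OrthGroup n × Euc n => ξ.space.orthogonalProjectionOnto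
      (((star q.1 : OrthGroup n) : Euc n →L[ℝ] Euc n) q.2) := by
    have h1 : Continuous fun q : OrthGroup n × Euc n =>
        ((star q.1 : OrthGroup n) : Euc n →L[ℝ] Euc n) :=
      (continuous_star.comp continuous_subtype_val).comp continuous_fst
    exact ξ.space.orthogonalProjectionOnto.continuous.comp (h1.clm_apply continuous_snd)
  have hev := K.isCompact.eventually_forall_of_forall_eventually (x₀ := g)
    (P := fun g x => ξ.space.orthogonalProjectionOnto
      (((star g : OrthGroup n) : Euc n →L[ℝ] Euc n) x) ∈ V)
    fun x hx => hcont.continuousAt.eventually_mem (hVo.mem_nhds (hKV ⟨x, hx, rfl⟩))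
  filter_upwards [hev] with g' hg'
  simp only [Set.mem_preimage, Set.mem_Iio, projVol_rotate]
  exact (measure_mono (Set.image_subset_iff.2 hg')).trans_lt hV

theorem measurable_projVol {n j : ℕ} (K : ConvexBody (Euc n)) :
    Measurable (projVol K : Gr n j → ℝ≥0∞) :=
  (upperSemicontinuous_projVol K).measurable

theorem Gr.haar_univ {n j : ℕ} (h : j ≤ n) : Gr.haar h Set.univ = 1 := by
  rw [Gr.haar, Measure.map_apply (Gr.continuous_rotate _).measurable MeasurableSet.univ,
    Set.preimage_univ, orthHaar]
  exact Measure.haarMeasure_self (K₀ := (⊤ : TopologicalSpace.PositiveCompacts (OrthGroup n)))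

open scoped Pointwise in
theorem projVol_smul {n j : ℕ} (K : ConvexBody (Euc n)) {ε : ℝ} (hε : 0 ≤ ε) (ξ : Gr n j) :
    projVol (ε • K) ξ = ENNReal.ofReal ε ^ j * projVol K ξ := by
  rw [projVol, ConvexBody.coe_smul, image_smul_set, Measure.addHaar_smul_of_nonneg _ hε,
    ξ.finrank_eq, ENNReal.ofReal_pow hε, projVol]

open scoped Pointwise in
/-- The Brunn–Minkowski inequality for projections. -/
theorem projVol_add {n j : ℕ} (hj : 0 < j) (K L : ConvexBody (Euc n)) (ξ : Gr n j) :
    projVol K ξ ^ (1 / (j : ℝ)) + projVol L ξ ^ (1 / (j : ℝ)) ≤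
      projVol (K + L) ξ ^ (1 / (j : ℝ)) := by
  have hc := ξ.space.orthogonalProjectionOnto.continuous
  have h := brunnMinkowski (K.isCompact.image hc) (L.isCompact.image hc) (K.nonempty.image _)
    (L.nonempty.image _) ξ.finrank_eq hj
  rwa [← Set.image_add] at h

theorem ballVol_ne_zero (j : ℕ) : ballVol j ≠ 0 :=
  (Metric.measure_closedBall_pos volume _ one_pos).ne'

theorem ballVol_ne_top (j : ℕ) : ballVol j ≠ ∞ := measure_closedBall_lt_top.ne

/-! ### Affine quermassintegrals -/

/-- The affine quermassintegral for `0 < j < n`, with values in `[0, ∞]`. -/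
noncomputable def affineQuermassENNReal {n j : ℕ} (h : j < n) (K : ConvexBody (Euc n)) : ℝ≥0∞ :=
  ballVol n * (∫⁻ ξ : Gr n j, (projVol K ξ / ballVol j) ^ (-(n : ℝ)) ∂(Gr.haar h.le)) ^
    (-(1 / (n : ℝ)))

theorem affineQuermass_eq_toReal {n j : ℕ} (hj : 0 < j) (h : j < n) (K : ConvexBody (Euc n)) :
    affineQuermass j K = (affineQuermassENNReal h K).toReal := by
  rw [affineQuermass, if_neg hj.ne', dif_pos h, affineQuermassENNReal]

/-- An infinite value would force the integral to vanish, hence infinite projection volumes almost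
everywhere for a probability measure. Finiteness lets the inequality pass to real numbers. -/
theorem affineQuermassENNReal_ne_top {n j : ℕ} (h : j < n) (K : ConvexBody (Euc n)) :
    affineQuermassENNReal h K ≠ ∞ := by
  have hn : 0 < (n : ℝ) := by exact_mod_cast (Nat.zero_le j).trans_lt h
  refine ENNReal.mul_ne_top (ballVol_ne_top n) fun htop => ?_
  have hI : ∫⁻ ξ : Gr n j, (projVol K ξ / ballVol j) ^ (-(n : ℝ)) ∂(Gr.haar h.le) = 0 := by
    rw [ENNReal.rpow_neg, ENNReal.inv_eq_top, ENNReal.rpow_eq_zero_iff] at htop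
    rcases htop with htop | htop
    · exact htop.1
    · exact absurd htop.2 (by simp)
  rw [lintegral_eq_zero_iff (((measurable_projVol K).div_const _).pow_const _)] at hI
  have hfalse : ∀ᵐ _ξ : Gr n j ∂(Gr.haar h.le), False := by
    filter_upwards [hI] with ξ hξ
    rw [Pi.zero_apply, ENNReal.rpow_neg, ENNReal.inv_eq_zero] at hξ
    exact ENNReal.rpow_ne_top_of_nonneg hn.le
      (ENNReal.div_ne_top (projVol_ne_top K ξ) (ballVol_ne_zero j)) hξ
  have h0 : Gr.haar (n := n) (j := j) h.le Set.univ = 0 := by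
    simpa [ae_iff] using hfalse
  simp [Gr.haar_univ] at h0

/-- The `j`-th root of the affine quermassintegral is a power mean with exponent `-nj`. -/
theorem affineQuermassENNReal_rpow {n j : ℕ} (hj : 0 < j) (h : j < n) (K : ConvexBody (Euc n)) :
    affineQuermassENNReal h K ^ (1 / (j : ℝ)) = ballVol n ^ (1 / (j : ℝ)) *
      (∫⁻ ξ : Gr n j, ((projVol K ξ / ballVol j) ^ (1 / (j : ℝ))) ^ (-((n : ℝ) * j))
        ∂(Gr.haar h.le)) ^ (-(1 / ((n : ℝ) * j))) := by
  have hj' : (j : ℝ) ≠ 0 := by exact_mod_cast hj.ne'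
  have hn' : (n : ℝ) ≠ 0 := by exact_mod_cast (hj.trans h).ne'
  simp only [affineQuermassENNReal, ← ENNReal.rpow_mul,
    show 1 / (j : ℝ) * -((n : ℝ) * j) = -n by field_simp]
  rw [ENNReal.mul_rpow_of_nonneg _ _ (by positivity), ← ENNReal.rpow_mul,
    show -(1 / (n : ℝ)) * (1 / j) = -(1 / ((n : ℝ) * j)) by field_simp]

/-- The Brunn–Minkowski inequality for affine quermassintegrals, with values in `[0, ∞]`. -/
theorem affineQuermassENNReal_add {n j : ℕ} (hj : 0 < j) (h : j < n) (K L : ConvexBody (Euc n)) :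
    affineQuermassENNReal h K ^ (1 / (j : ℝ)) + affineQuermassENNReal h L ^ (1 / (j : ℝ)) ≤
      affineQuermassENNReal h (K + L) ^ (1 / (j : ℝ)) := by
  have hj' : (0 : ℝ) < j := by exact_mod_cast hj
  have hn' : (0 : ℝ) < n := by exact_mod_cast hj.trans h
  have hm : ∀ M : ConvexBody (Euc n),
      Measurable fun ξ : Gr n j => (projVol M ξ / ballVol j) ^ (1 / (j : ℝ)) :=
    fun M => ((measurable_projVol M).div_const _).pow_const _
  rw [affineQuermassENNReal_rpow hj h, affineQuermassENNReal_rpow hj h,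
    affineQuermassENNReal_rpow hj h, ← mul_add]
  gcongr
  -- After the reverse Minkowski inequality, a fibrewise bound suffices: the two negative powers
  -- each reverse the order, so together they preserve it.
  refine (lintegral_rpow_neg_add_le _ (mul_pos hn' hj') (hm K) (hm L)).trans ?_
  refine ENNReal.rpow_neg_le_rpow_neg (by positivity) (lintegral_mono fun ξ =>
    ENNReal.rpow_neg_le_rpow_neg (by positivity) ?_)
  simp only [ENNReal.div_rpow_of_nonneg _ _ (one_div_pos.2 hj').le]
  rw [← ENNReal.add_div]
  exact ENNReal.div_le_div_right (projVol_add hj K L ξ) _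

theorem affineQuermassENNReal_smul {n j : ℕ} (h : j < n) (K : ConvexBody (Euc n)) {ε : ℝ}
    (hε : 0 < ε) : affineQuermassENNReal h (ε • K) =
      ENNReal.ofReal ε ^ j * affineQuermassENNReal h K := by
  have hn : (n : ℝ) ≠ 0 := by exact_mod_cast ((Nat.zero_le j).trans_lt h).ne'
  have hc0 : ENNReal.ofReal ε ^ j ≠ 0 := pow_ne_zero _ (by simpa using hε)
  have hct : ENNReal.ofReal ε ^ j ≠ ∞ := ENNReal.pow_ne_top ENNReal.ofReal_ne_top
  have hc0' : (ENNReal.ofReal ε ^ j) ^ (-(n : ℝ)) ≠ 0 := by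
    simp only [ne_eq, ENNReal.rpow_eq_zero_iff, hc0, hct, false_and, or_self, not_false_eq_true]
  have hct' : (ENNReal.ofReal ε ^ j) ^ (-(n : ℝ)) ≠ ∞ := by
    simp only [ne_eq, ENNReal.rpow_eq_top_iff, hc0, hct, false_and, or_self, not_false_eq_true]
  simp only [affineQuermassENNReal, projVol_smul K hε.le, mul_div_assoc,
    ENNReal.const_mul_rpow hc0 hct]
  rw [lintegral_const_mul' _ _ hct', ENNReal.const_mul_rpow hc0' hct', ← ENNReal.rpow_mul,
    show -(n : ℝ) * -(1 / n) = 1 by field_simp, ENNReal.rpow_one, mul_left_comm]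

theorem affineQuermass_nonneg {n : ℕ} (j : ℕ) (K : ConvexBody (Euc n)) :
    0 ≤ affineQuermass j K := by
  unfold affineQuermass
  split_ifs <;> exact ENNReal.toReal_nonneg

theorem affineQuermass_self {n : ℕ} (hn : 0 < n) (K : ConvexBody (Euc n)) :
    affineQuermass n K = (volume (K : Set (Euc n))).toReal := by
  rw [affineQuermass, if_neg hn.ne', dif_neg (lt_irrefl n)]

open scoped Pointwise in
theorem affineQuermass_smul {n j : ℕ} (hj : 0 < j) (hjn : j ≤ n) (K : ConvexBody (Euc n)) {ε : ℝ}
    (hε : 0 < ε) : affineQuermass j (ε • K) = ε ^ j * affineQuermass j K := by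
  rcases hjn.lt_or_eq with h | rfl
  · rw [affineQuermass_eq_toReal hj h, affineQuermass_eq_toReal hj h,
      affineQuermassENNReal_smul h K hε, ENNReal.toReal_mul, ENNReal.toReal_pow,
      ENNReal.toReal_ofReal hε.le]
  · rw [affineQuermass_self hj, affineQuermass_self hj, ConvexBody.coe_smul,
      Measure.addHaar_smul_of_nonneg _ hε.le, ENNReal.toReal_mul,
      ENNReal.toReal_ofReal (by positivity), finrank_euclideanSpace_fin]

theorem affineQuermass_add {n j : ℕ} (hj : 0 < j) (hjn : j ≤ n) (K L : ConvexBody (Euc n)) :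
    affineQuermass j K ^ (1 / (j : ℝ)) + affineQuermass j L ^ (1 / (j : ℝ)) ≤
      affineQuermass j (K + L) ^ (1 / (j : ℝ)) := by
  have hj' : 0 ≤ 1 / (j : ℝ) := by positivity
  have key : ∀ {a b c : ℝ≥0∞}, a ≠ ∞ → b ≠ ∞ → c ≠ ∞ →
      a ^ (1 / (j : ℝ)) + b ^ (1 / (j : ℝ)) ≤ c ^ (1 / (j : ℝ)) →
      a.toReal ^ (1 / (j : ℝ)) + b.toReal ^ (1 / (j : ℝ)) ≤ c.toReal ^ (1 / (j : ℝ)) := by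
    intro a b c ha hb hc habc
    rw [ENNReal.toReal_rpow, ENNReal.toReal_rpow, ENNReal.toReal_rpow,
      ← ENNReal.toReal_add (ENNReal.rpow_ne_top_of_nonneg hj' ha)
        (ENNReal.rpow_ne_top_of_nonneg hj' hb)]
    exact ENNReal.toReal_mono (ENNReal.rpow_ne_top_of_nonneg hj' hc) habc
  rcases hjn.lt_or_eq with h | rfl
  · simp only [affineQuermass_eq_toReal hj h]
    exact key (affineQuermassENNReal_ne_top h K) (affineQuermassENNReal_ne_top h L)
      (affineQuermassENNReal_ne_top h _) (affineQuermassENNReal_add hj h K L)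
  · simp only [affineQuermass_self hj]
    exact key K.isCompact.measure_lt_top.ne L.isCompact.measure_lt_top.ne
      (K + L).isCompact.measure_lt_top.ne (brunnMinkowski K.isCompact L.isCompact K.nonempty
        L.nonempty finrank_euclideanSpace_fin hj)

/-- The Brunn–Minkowski inequality for affine quermassintegrals. -/
theorem theorem2p3 (n j : ℕ) (hj : 0 < j) (hjn : j ≤ n)
    (K L : ConvexBody (EuclideanSpace ℝ (Fin n))) (hK : 0 ∈ K) (hL : 0 ∈ L)
    (ε : ℝ) (hε : 0 < ε) :
    affineQuermass j (K + ε • L) ^ (1 / (j : ℝ)) ≥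
      affineQuermass j K ^ (1 / (j : ℝ)) + ε * affineQuermass j L ^ (1 / (j : ℝ)) := by
  have h := affineQuermass_add hj hjn K (ε • L)
  rwa [affineQuermass_smul hj hjn L hε, Real.mul_rpow (by positivity) (affineQuermass_nonneg j L),
    one_div, Real.pow_rpow_inv_natCast hε.le hj.ne', ← one_div] at h
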